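/- Let $d\ge 2$ and $N\ge 2$ be integers. A tube of width $w>0$ in $\mathbb{R}^d$ is the closed $w/2$-neighbourhood of a line, and a set $K\subset\mathbb{R}^d$ is called tube-null if for every $\epsilon>0$ there are tubes $T_1,T_2,\dots$ of widths $w_1,w_2,\dots$ with $K\subset\bigcup_n T_n$ and $\sum_n w_n^{d-1}<\epsilon$. Let $\mathcal{F}$ be a finite collection of maps $f:\mathbb{R}^d\to\mathbb{R}^d$ of the form $$f(x)=\frac{R(x)}{N}+\frac{i}{N},$$ where $R$ is an isometry of $\mathbb{R}^d$ that maps the unit cube $[0,1]^d$ onto itself and $i\in\{0,1,\dots,N-1\}^d$ ($R$ and $i$ may depend on the map, $N$ may not). Let $\mathcal{G}$ be a directed graph with $q$ vertices $1,\dots,q$ (several edges between the same two vertices, and loops, are allowed) such that there is a directed path from any vertex to any other, and let every edge $e$ carry a map $f_e\in\mathcal{F}$. Let $K_1,\dots,K_q\subset\mathbb{R}^d$ be the associated graph directed attractors, i.e. the non-empty compact sets with $$K_i=\bigcup_{j=1}^q\ \bigcup_{e\in\mathcal{E}_{i,j}}f_e(K_j)\qquad(i=1,\dots,q),$$ where $\mathcal{E}_{i,j}$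 is the set of edges from $i$ to $j$. Then, for each $i\in\{1,\dots,q\}$, the set $K_i$ is tube-null if and only if $\mathcal{L}^d(K_j)=0$ for every $j=1,\dots,q$, where $\mathcal{L}^d$ is Lebesgue measure. -/

import Mathlib

/-- The closed unit cube `[0,1]^d` in Euclidean space. -/
def unitCube (d : ℕ) : Set (EuclideanSpace ℝ (Fin d)) :=
  {x | ∀ k, x k ∈ Set.Icc (0 : ℝ) 1}

/-- `T` is a tube of width `w > 0`: the closed `w/2`-neighbourhood of a line. -/
def IsTube {d : ℕ} (w : ℝ) (T : Set (EuclideanSpace ℝ (Fin d))) : Prop :=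
  0 < w ∧ ∃ p v : EuclideanSpace ℝ (Fin d), v ≠ 0 ∧
    T = Metric.cthickening (w / 2) (Set.range fun t : ℝ => p + t • v)

/-- `K ⊆ ℝ^d` is tube-null: for every `ε > 0` it is covered by countably many tubes `T_n` of
widths `w_n` with `∑ w_n^(d-1) < ε`. -/
def TubeNull {d : ℕ} (K : Set (EuclideanSpace ℝ (Fin d))) : Prop :=
  ∀ ε : ℝ, 0 < ε →
    ∃ (T : ℕ → Set (EuclideanSpace ℝ (Fin d))) (w : ℕ → ℝ),
      (∀ n, IsTube (w n) (T n)) ∧ K ⊆ ⋃ n, T n ∧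
        Summable (fun n => w n ^ (d - 1)) ∧ ∑' n, w n ^ (d - 1) < ε

/-- Maps of the form `f(x) = R(x)/N + i/N`, where `R` is an isometry of `ℝ^d` that maps the unit
cube to itself and `i ∈ {0,…,N-1}^d`. -/
def IsGridMap {d : ℕ} (N : ℕ)
    (f : EuclideanSpace ℝ (Fin d) → EuclideanSpace ℝ (Fin d)) : Prop :=
  ∃ (R : EuclideanSpace ℝ (Fin d) ≃ᵢ EuclideanSpace ℝ (Fin d)) (i : Fin d → Fin N),
    R '' unitCube d = unitCube d ∧
      ∀ x k, f x k = R x k / (N : ℝ) + ((i k : ℕ) : ℝ) / (N : ℝ)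

/-- The family `K` consists of the graph directed sets of the directed multigraph on `V` whose
edge `e : i ⟶ j` carries the map `f e`: the sets `K i` are non-empty and compact, and
`K i = ⋃ j, ⋃ e : i ⟶ j, f e (K j)`. -/
structure IsGraphDirected {V : Type*} [Quiver V] {X : Type*} [TopologicalSpace X]
    (f : ∀ {i j : V}, (i ⟶ j) → X → X) (K : V → Set X) : Prop where
  nonempty : ∀ i, (K i).Nonempty
  isCompact : ∀ i, IsCompact (K i)
  eq_iUnion : ∀ i, K i = ⋃ j, ⋃ e : i ⟶ j, f e '' K j

/-! If every `K j` is null, then so is the union of all integer translates of the images `A '' K j`,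
where `A` runs over the finitely many linear isometries preserving `ℤ ^ d`. Modulo `ℤ ^ d` this
union is a closed proper subset `Q` of the torus. A grid map satisfies `N • g x = A x + b` with `b`
integral, so the orbit of each `x ∈ K i` under multiplication by `N` stays in `Q`.

Some trigonometric polynomial is small on `Q` compared with its constant term. Averaging it over `n`
steps of the orbit forces `‖lacunarySum N n (k · x)‖ ≥ n * c` for some `k ≠ 0` in a fixed finite set
(`exists_lacunarySum_ge`).

By orthogonality, only a proportion `O(1/n)` of the grid of mesh `N ^ (-n)` carries so large a sum.
Hence `x` lies in one of `O(N ^ n / n)` slabs of thickness about `N ^ (-n)` orthogonal to `k`. In a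
bounded region each slab is covered by `O(N ^ (n * (d - 2)))` tubes of width comparable to `N ^
(-n)`, so the total cost is `O(1/n)` (`hasTubeCover_lacunarySum`).

Conversely, a tube of width `w ≤ 1` meets a ball in volume `O(w ^ (d - 1))`, so a tube-null `K i` is
null. Nullity passes along edges because `f e '' K j ⊆ K i`, and strong connectedness carries it to
every vertex. -/

/-! ### Lacunary exponential sums on the `N`-adic grid -/

/-- The exponential sum `∑_{j < n} e(N ^ j t)`, where `e(t) = exp (2πit)`. -/
noncomputable def lacunarySum (N n : ℕ) (t : ℝ) : ℂ :=
  ∑ j ∈ Finset.range n, Complex.exp (2 * Real.pi * Complex.I * ((N : ℂ) ^ j * t))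

theorem sum_range_exp_mul_div {M : ℕ} (hM : 0 < M) (P : ℕ) (a : ℤ) (ha : ¬ (M : ℤ) ∣ a) :
    ∑ m ∈ Finset.range (P * M), Complex.exp (2 * Real.pi * Complex.I * (a * (m / M))) = 0 := by
  have hM' : (M : ℂ) ≠ 0 := by exact_mod_cast hM.ne'
  have h2 : (2 * Real.pi * Complex.I : ℂ) ≠ 0 := Complex.two_pi_I_ne_zero
  set z := Complex.exp (2 * Real.pi * Complex.I * (a / M)) with hz
  have h1 : ∀ m : ℕ, Complex.exp (2 * Real.pi * Complex.I * (a * (m / M))) = z ^ m := by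
    intro m
    rw [hz, ← Complex.exp_nat_mul]
    congr 1
    ring
  have hz1 : z ≠ 1 := by
    intro h
    rw [hz, Complex.exp_eq_one_iff] at h
    obtain ⟨n, hn⟩ := h
    apply ha
    refine ⟨n, ?_⟩
    have h3 : (a : ℂ) / M = n := by
      apply mul_left_cancel₀ h2
      rw [hn]; ring
    rw [div_eq_iff hM'] at h3
    have : (a : ℂ) = ((M * n : ℤ) : ℂ) := by rw [h3]; push_cast; ring
    exact_mod_cast this
  have hzP : z ^ (P * M) = 1 := by
    rw [hz, ← Complex.exp_nat_mul, Complex.exp_eq_one_iff]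
    refine ⟨P * a, ?_⟩
    push_cast
    field_simp
  simp_rw [h1]
  rw [geom_sum_eq hz1, hzP]
  simp

theorem normSq_lacunarySum (N n : ℕ) (t : ℝ) :
    ((‖lacunarySum N n t‖ ^ 2 : ℝ) : ℂ) = ∑ i ∈ Finset.range n, ∑ j ∈ Finset.range n,
      Complex.exp (2 * Real.pi * Complex.I * ((((N : ℤ) ^ i - (N : ℤ) ^ j : ℤ) : ℂ) * t)) := by
  rw [Complex.ofReal_pow, ← Complex.mul_conj', lacunarySum, map_sum, Finset.sum_mul_sum]
  refine Finset.sum_congr rfl fun i _ => Finset.sum_congr rfl fun j _ => ?_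
  rw [← Complex.exp_conj, ← Complex.exp_add]
  congr 1
  simp only [map_mul, map_pow, Complex.conj_I, Complex.conj_ofReal, map_natCast, map_ofNat]
  push_cast
  ring

/-- Orthogonality: the mean square of a lacunary sum over the grid of mesh `N ^ (-n)`. -/
theorem sum_normSq_lacunarySum {N : ℕ} (hN : 2 ≤ N) (n P : ℕ) :
    ∑ m ∈ Finset.range (P * N ^ n), ‖lacunarySum N n ((m : ℝ) / (N : ℝ) ^ n)‖ ^ 2
      = P * (N : ℝ) ^ n * n := by
  have hNn : 0 < N ^ n := by positivity
  have key : ∀ i < n, ∀ j < n, ∑ m ∈ Finset.range (P * N ^ n),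
      Complex.exp (2 * Real.pi * Complex.I * ((((N : ℤ) ^ i - (N : ℤ) ^ j : ℤ) : ℂ) *
        (((m : ℝ) / (N : ℝ) ^ n : ℝ) : ℂ))) = if i = j then (P * (N : ℂ) ^ n) else 0 := by
    intro i hi j hj
    split_ifs with h
    · subst h; simp
    · have := sum_range_exp_mul_div hNn P ((N : ℤ) ^ i - (N : ℤ) ^ j) ?_
      · rw [← this]
        push_cast
        rfl
      · intro hdvd
        have hi' : (N : ℤ) ^ i < (N : ℤ) ^ n := by exact_mod_cast Nat.pow_lt_pow_right hN hi
        have hj' : (N : ℤ) ^ j < (N : ℤ) ^ n := by exact_mod_cast Nat.pow_lt_pow_right hN hj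
        have hi0 : 0 < (N : ℤ) ^ i := by positivity
        have hj0 : 0 < (N : ℤ) ^ j := by positivity
        -- Both frequencies lie strictly between `0` and `N ^ n`, so they are congruent modulo `N ^
        -- n` only if equal.
        have h0 := Int.eq_zero_of_abs_lt_dvd hdvd (by
          push_cast; rw [abs_lt]; constructor <;> linarith)
        have h1 : N ^ i = N ^ j := by exact_mod_cast sub_eq_zero.mp h0
        exact h (Nat.pow_right_injective hN h1)
  have hC : ((∑ m ∈ Finset.range (P * N ^ n),
      ‖lacunarySum N n ((m : ℝ) / (N : ℝ) ^ n)‖ ^ 2 : ℝ) : ℂ) = ((P * (N : ℝ) ^ n * n : ℝ) : ℂ) := by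
    rw [Complex.ofReal_sum]
    simp_rw [normSq_lacunarySum]
    rw [Finset.sum_comm]
    calc _ = ∑ i ∈ Finset.range n, ∑ j ∈ Finset.range n,
          if i = j then (P * (N : ℂ) ^ n) else 0 := by
          refine Finset.sum_congr rfl fun i hi => ?_
          rw [Finset.sum_comm]
          refine Finset.sum_congr rfl fun j hj => ?_
          exact key i (Finset.mem_range.mp hi) j (Finset.mem_range.mp hj)
      _ = ∑ i ∈ Finset.range n, (P * (N : ℂ) ^ n) := by
          refine Finset.sum_congr rfl fun i hi => ?_
          rw [Finset.sum_ite_eq, if_pos hi]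
      _ = _ := by
          rw [Finset.sum_const, Finset.card_range]
          push_cast
          rw [nsmul_eq_mul]; ring
  exact_mod_cast hC

/-- Few points of the grid of mesh `N ^ (-n)` have a large lacunary sum. -/
theorem card_filter_lacunarySum_le {N : ℕ} (hN : 2 ≤ N) {n : ℕ} (hn : 0 < n) (P : ℕ) {c : ℝ}
    (hc : 0 < c) :
    (((Finset.range (P * N ^ n)).filter
      fun m : ℕ => n * c ≤ ‖lacunarySum N n ((m : ℝ) / (N : ℝ) ^ n)‖).card : ℝ)
      ≤ P * (N : ℝ) ^ n / (n * c ^ 2) := by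
  set S := (Finset.range (P * N ^ n)).filter
      fun m : ℕ => n * c ≤ ‖lacunarySum N n ((m : ℝ) / (N : ℝ) ^ n)‖
  have hn' : (0 : ℝ) < n := by exact_mod_cast hn
  have h : S.card * (n * c) ^ 2 ≤ P * (N : ℝ) ^ n * n := by
    rw [← sum_normSq_lacunarySum hN, ← nsmul_eq_mul]
    calc _ ≤ ∑ m ∈ S, ‖lacunarySum N n ((m : ℝ) / (N : ℝ) ^ n)‖ ^ 2 := by
          apply Finset.card_nsmul_le_sum
          intro m hm
          have := (Finset.mem_filter.mp hm).2
          gcongr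
      _ ≤ _ := Finset.sum_le_sum_of_subset_of_nonneg (Finset.filter_subset _ _)
          fun _ _ _ => by positivity
  rw [le_div_iff₀ (by positivity)]
  have h2 : S.card * (n * c ^ 2) * n ≤ P * (N : ℝ) ^ n * n := by
    calc _ = S.card * (n * c) ^ 2 := by ring
      _ ≤ _ := h
  exact le_of_mul_le_mul_right h2 hn'

/-- The `j`-th term has Lipschitz constant `2π N ^ j`, and these form a geometric series dominated
by `N ^ n`. Rounding to the grid thus costs a constant independent of `n`, negligible against `n *
c`. -/
theorem norm_lacunarySum_sub_le {N : ℕ} (hN : 2 ≤ N) (n : ℕ) {s t : ℝ}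
    (h : |s - t| ≤ 1 / (N : ℝ) ^ n) :
    ‖lacunarySum N n s - lacunarySum N n t‖ ≤ 2 * Real.pi := by
  have hN0 : (0 : ℝ) < (N : ℝ) ^ n := by positivity
  rw [lacunarySum, lacunarySum, ← Finset.sum_sub_distrib]
  have hterm : ∀ j, ‖Complex.exp (2 * Real.pi * Complex.I * ((N : ℂ) ^ j * s)) -
      Complex.exp (2 * Real.pi * Complex.I * ((N : ℂ) ^ j * t))‖
      ≤ 2 * Real.pi / (N : ℝ) ^ n * (N : ℝ) ^ j := by
    intro j
    have e1 : Complex.exp (2 * Real.pi * Complex.I * ((N : ℂ) ^ j * s)) -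
      Complex.exp (2 * Real.pi * Complex.I * ((N : ℂ) ^ j * t)) =
      Complex.exp (((2 * Real.pi * ((N : ℝ) ^ j * t) : ℝ) : ℂ) * Complex.I) *
        (Complex.exp (Complex.I * ((2 * Real.pi * ((N : ℝ) ^ j * (s - t)) : ℝ) : ℂ)) - 1) := by
      rw [mul_sub, ← Complex.exp_add, mul_one]
      congr 2 <;> · push_cast; ring
    rw [e1, norm_mul, Complex.norm_exp_ofReal_mul_I, one_mul]
    refine (Real.norm_exp_I_mul_ofReal_sub_one_le).trans ?_
    rw [Real.norm_eq_abs, abs_mul, abs_mul, abs_mul, abs_of_pos Real.pi_pos, abs_two,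
      abs_of_nonneg (by positivity : (0 : ℝ) ≤ (N : ℝ) ^ j)]
    calc _ ≤ 2 * Real.pi * ((N : ℝ) ^ j * (1 / (N : ℝ) ^ n)) := by gcongr
      _ = _ := by ring
  refine (norm_sum_le _ _).trans ((Finset.sum_le_sum fun j _ => hterm j).trans ?_)
  rw [← Finset.mul_sum]
  have : (∑ j ∈ Finset.range n, (N : ℝ) ^ j) ≤ (N : ℝ) ^ n := by
    have := Nat.geomSum_lt hN (s := Finset.range n) (n := n) (fun k hk => Finset.mem_range.mp hk)
    exact_mod_cast this.le
  calc _ ≤ 2 * Real.pi / (N : ℝ) ^ n * (N : ℝ) ^ n := by gcongr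
    _ = _ := by field_simp

theorem lacunarySum_add_natCast (N n : ℕ) (t : ℝ) (L : ℕ) :
    lacunarySum N n (t + L) = lacunarySum N n t := by
  refine Finset.sum_congr rfl fun j _ => ?_
  rw [Complex.exp_eq_exp_iff_exists_int]
  refine ⟨N ^ j * L, ?_⟩
  push_cast
  ring

/-! ### Finite tube covers -/

/-- `E` is covered by finitely many tubes of total cost at most `ε`. -/
def HasTubeCover {d : ℕ} (E : Set (EuclideanSpace ℝ (Fin d))) (ε : ℝ) : Prop :=
  ∃ s : Finset (Set (EuclideanSpace ℝ (Fin d)) × ℝ), (∀ p ∈ s, IsTube p.2 p.1) ∧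
    E ⊆ ⋃ p ∈ s, p.1 ∧ ∑ p ∈ s, p.2 ^ (d - 1) ≤ ε

theorem HasTubeCover.mono {d : ℕ} {E E' : Set (EuclideanSpace ℝ (Fin d))} {ε ε' : ℝ}
    (h : HasTubeCover E ε) (hE : E' ⊆ E) (hε : ε ≤ ε') : HasTubeCover E' ε' := by
  obtain ⟨s, h1, h2, h3⟩ := h
  exact ⟨s, h1, hE.trans h2, h3.trans hε⟩

theorem HasTubeCover.union {d : ℕ} {E E' : Set (EuclideanSpace ℝ (Fin d))} {ε ε' : ℝ}
    (h : HasTubeCover E ε) (h' : HasTubeCover E' ε') : HasTubeCover (E ∪ E') (ε + ε') := by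
  classical
  obtain ⟨s, h1, h2, h3⟩ := h
  obtain ⟨s', h1', h2', h3'⟩ := h'
  refine ⟨s ∪ s', ?_, ?_, ?_⟩
  · intro p hp
    rcases Finset.mem_union.mp hp with hp | hp
    exacts [h1 p hp, h1' p hp]
  · rw [Finset.set_biUnion_union]
    exact Set.union_subset_union h2 h2'
  · have := Finset.sum_union_inter (s₁ := s) (s₂ := s')
      (f := fun p : Set (EuclideanSpace ℝ (Fin d)) × ℝ => p.2 ^ (d - 1))
    have h0 : 0 ≤ ∑ p ∈ s ∩ s', p.2 ^ (d - 1) :=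
      Finset.sum_nonneg fun p hp => pow_nonneg (h1 p (Finset.mem_inter.mp hp).1).1.le _
    linarith

theorem HasTubeCover.biUnion {d : ℕ} {ι : Type*} (F : Finset ι)
    (E : ι → Set (EuclideanSpace ℝ (Fin d))) {ε : ℝ} (h : ∀ k ∈ F, HasTubeCover (E k) ε) :
    HasTubeCover (⋃ k ∈ F, E k) (F.card * ε) := by
  classical
  induction F using Finset.induction_on with
  | empty => exact ⟨∅, by simp, by simp, by simp⟩
  | insert a F ha ih =>
    rw [Finset.set_biUnion_insert, Finset.card_insert_of_notMem ha]
    have := (h a (Finset.mem_insert_self _ _)).union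
      (ih fun k hk => h k (Finset.mem_insert_of_mem hk))
    refine this.mono le_rfl ?_
    push_cast
    linarith

theorem exists_isTube {d : ℕ} (hd : 0 < d) {w : ℝ} (hw : 0 < w) :
    ∃ T : Set (EuclideanSpace ℝ (Fin d)), IsTube w T :=
  ⟨_, hw, 0, EuclideanSpace.single ⟨0, hd⟩ 1, by simp, rfl⟩

theorem TubeNull.of_hasTubeCover {d : ℕ} (hd : 2 ≤ d) {K : Set (EuclideanSpace ℝ (Fin d))}
    (h : ∀ ε > 0, HasTubeCover K ε) : TubeNull K := by
  intro ε hε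
  obtain ⟨s, h1, h2, h3⟩ := h (ε / 4) (by positivity)
  -- The sequence of tubes must be infinite, so the finite cover is padded with widths `δ / 2 ^ n`.
  -- The cap at `1` makes each padding cost at most its width, so the total is at most `ε / 4 + 2 *
  -- δ < ε`.
  set δ := min (ε / 4) 1 with hδ
  have hδ0 : 0 < δ := by positivity
  have hpos : ∀ n : ℕ, 0 < δ * (1 / 2 : ℝ) ^ n := fun n => by positivity
  choose T0 hT0 using fun n : ℕ => exists_isTube (d := d) (by omega) (hpos n)
  set e := s.equivFin
  let p : ℕ → Set (EuclideanSpace ℝ (Fin d)) × ℝ := fun n =>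
    if hn : n < s.card then (e.symm ⟨n, hn⟩ : _) else (T0 n, δ * (1 / 2 : ℝ) ^ n)
  let a : ℕ → ℝ := fun n => if hn : n < s.card then
    (e.symm ⟨n, hn⟩ : Set (EuclideanSpace ℝ (Fin d)) × ℝ).2 ^ (d - 1) else 0
  have hp : ∀ n, IsTube (p n).2 (p n).1 := by
    intro n
    by_cases hn : n < s.card
    · simp only [p, dif_pos hn]
      exact h1 _ (e.symm ⟨n, hn⟩).2
    · simp only [p, dif_neg hn]
      exact hT0 n
  have ha : HasSum a (∑ q ∈ s, q.2 ^ (d - 1)) := by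
    have h5 : ∑ n ∈ Finset.range s.card, a n = ∑ q ∈ s, q.2 ^ (d - 1) := by
      rw [Finset.sum_range, ← Finset.sum_coe_sort s, ← e.symm.sum_comp]
      refine Finset.sum_congr rfl fun i _ => ?_
      simp only [a, dif_pos i.2]
    rw [← h5]
    exact hasSum_sum_of_ne_finset_zero fun n hn => by
      simp only [a, dif_neg (by simpa using hn : ¬ n < s.card)]
  have hb : HasSum (fun n : ℕ => δ * (1 / 2 : ℝ) ^ n) (δ * 2) := hasSum_geometric_two.mul_left δ
  have hab := ha.add hb
  have hle : ∀ n, (p n).2 ^ (d - 1) ≤ a n + δ * (1 / 2 : ℝ) ^ n := by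
    intro n
    by_cases hn : n < s.card
    · simp only [p, a, dif_pos hn]
      linarith [hpos n]
    · simp only [p, a, dif_neg hn, zero_add]
      refine pow_le_of_le_one (hpos n).le ?_ (by omega)
      calc δ * (1 / 2 : ℝ) ^ n ≤ 1 * 1 := by
            gcongr
            · exact min_le_right _ _
            · exact pow_le_one₀ (by norm_num) (by norm_num)
        _ = 1 := by norm_num
  have hsum : Summable fun n => (p n).2 ^ (d - 1) :=
    Summable.of_nonneg_of_le (fun n => pow_nonneg (hp n).1.le _) hle hab.summable
  refine ⟨fun n => (p n).1, fun n => (p n).2, hp, ?_, hsum, ?_⟩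
  · intro x hx
    obtain ⟨q, hq, hxq⟩ := Set.mem_iUnion₂.mp (h2 hx)
    refine Set.mem_iUnion.mpr ⟨e ⟨q, hq⟩, ?_⟩
    simp only [p, dif_pos (e ⟨q, hq⟩).2]
    simpa using hxq
  · have h6 : ∑' n, (p n).2 ^ (d - 1) ≤ ∑ q ∈ s, q.2 ^ (d - 1) + δ * 2 := by
      rw [← hab.tsum_eq]
      exact hsum.tsum_le_tsum hle hab.summable
    have h7 : δ ≤ ε / 4 := min_le_left _ _
    linarith

/-! ### Tubes covering the points with a large lacunary sum -/

/-- Since `k p ≠ 0`, the `d - 1` functionals used here are linearly independent and their common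
kernel is a line. Together they therefore control the distance to that line. -/
theorem exists_norm_sub_smul_le {d : ℕ} (k : Fin d → ℤ) {p r : Fin d} (hp : k p ≠ 0)
    (hpr : p ≠ r) :
    ∃ v : EuclideanSpace ℝ (Fin d), v ≠ 0 ∧ ∃ C > 0, ∀ (z : EuclideanSpace ℝ (Fin d)) (δ : ℝ),
      (∀ l, l ≠ p → l ≠ r → |z l| ≤ δ) → |∑ l, k l * z l| ≤ δ → ∃ s : ℝ, ‖z - s • v‖ ≤ C * δ := by
  have hkp : (k p : ℝ) ≠ 0 := by exact_mod_cast hp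
  have hkp1 : 1 ≤ |(k p : ℝ)| := by exact_mod_cast Int.one_le_abs hp
  set v : EuclideanSpace ℝ (Fin d) :=
    (k p : ℝ) • EuclideanSpace.single r 1 - (k r : ℝ) • EuclideanSpace.single p 1 with hv
  have hvr : v r = k p := by simp [hv, hpr.symm]
  have hvp : v p = - k r := by simp [hv, hpr]
  have hvl : ∀ l, l ≠ p → l ≠ r → v l = 0 := by
    intro l h1 h2; simp [hv, h1, h2]
  have hkv : ∑ l, (k l : ℝ) * v l = 0 := by
    rw [← Finset.add_sum_erase _ _ (Finset.mem_univ p), ← Finset.add_sum_erase _ _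
      (Finset.mem_erase.mpr ⟨hpr.symm, Finset.mem_univ r⟩), hvr, hvp, Finset.sum_eq_zero]
    · ring
    · intro l hl
      simp only [Finset.mem_erase] at hl
      rw [hvl l hl.2.1 hl.1, mul_zero]
  set B : ℝ := 1 + ∑ l, |(k l : ℝ)| with hB
  have hB1 : 1 ≤ B := le_add_of_nonneg_right (Finset.sum_nonneg fun l _ => abs_nonneg _)
  have hd0 : 0 < (d : ℝ) := by exact_mod_cast p.pos
  refine ⟨v, ?_, d * B, by positivity, ?_⟩
  · intro h
    rw [h] at hvr
    exact hkp (by simpa using hvr.symm)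
  intro z δ hz hkz
  have hδ : 0 ≤ δ := (abs_nonneg _).trans hkz
  -- This multiple of `v` cancels the coordinate `r`; the coordinate `p` is then recovered from `k ·
  -- y`.
  refine ⟨z r / k p, ?_⟩
  set y := z - (z r / k p) • v with hy
  have hyl : ∀ l, y l = z l - z r / k p * v l := fun l => by simp [hy]
  have hyr : y r = 0 := by rw [hyl, hvr]; field_simp; ring
  have hyl' : ∀ l, l ≠ p → |y l| ≤ δ := by
    intro l hl
    by_cases h : l = r
    · rw [h, hyr]; simpa using hδ
    · rw [hyl, hvl l hl h]; simpa using hz l hl h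
  have hky : ∑ l, (k l : ℝ) * y l = ∑ l, k l * z l := by
    have : ∀ l, (k l : ℝ) * y l = k l * z l - z r / k p * (k l * v l) := fun l => by
      rw [hyl]; ring
    simp_rw [this]
    rw [Finset.sum_sub_distrib, ← Finset.mul_sum, hkv]; simp
  have hyp : |y p| ≤ B * δ := by
    have h1 : (k p : ℝ) * y p = ∑ l, k l * z l - ∑ l ∈ Finset.univ.erase p, k l * y l := by
      rw [← hky, ← Finset.add_sum_erase _ _ (Finset.mem_univ p)]; ring
    calc |y p| ≤ |(k p : ℝ)| * |y p| := le_mul_of_one_le_left (abs_nonneg _) hkp1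
      _ = |∑ l, k l * z l - ∑ l ∈ Finset.univ.erase p, k l * y l| := by rw [← abs_mul, h1]
      _ ≤ |∑ l, k l * z l| + |∑ l ∈ Finset.univ.erase p, k l * y l| := abs_sub _ _
      _ ≤ δ + ∑ l ∈ Finset.univ.erase p, |(k l : ℝ)| * δ := by
          refine add_le_add hkz ((Finset.abs_sum_le_sum_abs _ _).trans (Finset.sum_le_sum ?_))
          intro l hl
          rw [abs_mul]
          gcongr
          exact hyl' l (Finset.ne_of_mem_erase hl)
      _ ≤ δ + ∑ l, |(k l : ℝ)| * δ := by
          gcongr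
          exact Finset.subset_univ _
      _ = B * δ := by rw [hB, ← Finset.sum_mul]; ring
  have hall : ∀ l, |y l| ≤ B * δ := by
    intro l
    by_cases h : l = p
    · rw [h]; exact hyp
    · exact (hyl' l h).trans (le_mul_of_one_le_left hδ hB1)
  calc ‖y‖ = ‖∑ l, EuclideanSpace.single l (y l)‖ := by
        congr 1; ext l; simp [Finset.sum_apply]
    _ ≤ ∑ l, ‖EuclideanSpace.single l (y l)‖ := norm_sum_le _ _
    _ ≤ ∑ l : Fin d, B * δ := Finset.sum_le_sum fun l _ => by simpa using hall l
    _ = d * B * δ := by simp; ring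

/-- If the cells of a map to a finite index set are each close to a line in a fixed direction,
then the set is covered by that many tubes. -/
theorem HasTubeCover.of_cells {d : ℕ} {ι : Type*} {E : Set (EuclideanSpace ℝ (Fin d))}
    (S : Finset ι) (φ : EuclideanSpace ℝ (Fin d) → ι) (hφ : ∀ x ∈ E, φ x ∈ S)
    {v : EuclideanSpace ℝ (Fin d)} (hv : v ≠ 0) {η : ℝ} (hη : 0 < η)
    (h : ∀ x ∈ E, ∀ y ∈ E, φ x = φ y → ∃ s : ℝ, ‖x - y - s • v‖ ≤ η) :
    HasTubeCover E (S.card * (2 * η) ^ (d - 1)) := by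
  classical
  have hy : ∀ i, ∃ y, (∃ x ∈ E, φ x = i) → y ∈ E ∧ φ y = i := by
    intro i
    by_cases hi : ∃ x ∈ E, φ x = i
    · obtain ⟨x, hx⟩ := hi
      exact ⟨x, fun _ => hx⟩
    · exact ⟨0, fun h => (hi h).elim⟩
  choose y hy using hy
  let T : ι → Set (EuclideanSpace ℝ (Fin d)) × ℝ := fun i =>
    (Metric.cthickening (2 * η / 2) (Set.range fun t : ℝ => y i + t • v), 2 * η)
  refine ⟨S.image T, ?_, ?_, ?_⟩
  · intro q hq
    obtain ⟨i, -, rfl⟩ := Finset.mem_image.mp hq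
    exact ⟨by positivity, y i, v, hv, rfl⟩
  · intro x hx
    obtain ⟨hyE, hyφ⟩ := hy (φ x) ⟨x, hx, rfl⟩
    obtain ⟨s, hs⟩ := h x hx _ hyE hyφ.symm
    refine Set.mem_iUnion₂.mpr ⟨T (φ x), Finset.mem_image_of_mem _ (hφ x hx), ?_⟩
    refine Metric.mem_cthickening_of_dist_le x (y (φ x) + s • v) _ _ ⟨s, rfl⟩ ?_
    rw [dist_eq_norm, ← sub_sub]
    linarith
  · calc ∑ q ∈ S.image T, q.2 ^ (d - 1) = ∑ q ∈ S.image T, (2 * η) ^ (d - 1) := by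
          refine Finset.sum_congr rfl fun q hq => ?_
          obtain ⟨i, -, rfl⟩ := Finset.mem_image.mp hq
          rfl
      _ = (S.image T).card * (2 * η) ^ (d - 1) := by rw [Finset.sum_const, nsmul_eq_mul]
      _ ≤ _ := by gcongr; exact Finset.card_image_le

theorem abs_sub_le_of_natFloor_mul_eq {M : ℝ} (hM : 0 < M) {a b : ℝ} (ha : 0 ≤ a) (hb : 0 ≤ b)
    (h : ⌊M * a⌋₊ = ⌊M * b⌋₊) : |a - b| ≤ 1 / M := by
  have ha' := Nat.floor_le (mul_nonneg hM.le ha)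
  have ha'' := Nat.lt_floor_add_one (M * a)
  have hb' := Nat.floor_le (mul_nonneg hM.le hb)
  have hb'' := Nat.lt_floor_add_one (M * b)
  rw [h] at ha' ha''
  rw [le_div_iff₀ hM]
  calc |a - b| * M = |M * a - M * b| := by
        rw [← mul_sub, abs_mul, abs_of_pos hM, mul_comm]
    _ ≤ 1 := by rw [abs_le]; constructor <;> linarith

/-- Points of a bounded set at which the lacunary sum in the frequency `k ≠ 0` is large can be
covered by tubes of small total cost. -/
theorem hasTubeCover_lacunarySum {d N : ℕ} (hd : 2 ≤ d) (hN : 2 ≤ N) (k : Fin d → ℤ) (hk : k ≠ 0)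
    {c : ℝ} (hc : 0 < c) (ρ : ℝ) :
    ∃ C : ℝ, ∀ n : ℕ, 0 < n → 4 * Real.pi ≤ n * c → HasTubeCover
      {x : EuclideanSpace ℝ (Fin d) | ‖x‖ ≤ ρ ∧ n * c ≤ ‖lacunarySum N n (∑ l, k l * x l)‖}
      (C / n) := by
  classical
  obtain ⟨p, hp⟩ := Function.ne_iff.mp hk
  have : Nontrivial (Fin d) := Fin.nontrivial_iff_two_le.mpr hd
  obtain ⟨r, hr⟩ := exists_ne p
  obtain ⟨v, hv, A, hA, hvA⟩ := exists_norm_sub_smul_le k (p := p) (r := r) hp hr.symm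
  set B : ℝ := 1 + ∑ l, |(k l : ℝ)| with hB
  have hB1 : 1 ≤ B := le_add_of_nonneg_right (Finset.sum_nonneg fun l _ => abs_nonneg _)
  obtain ⟨L, hL⟩ := exists_nat_gt (B * |ρ|)
  refine ⟨2 * L * 4 / c ^ 2 * (2 * L) ^ (d - 2) * (2 * A) ^ (d - 1), fun n hn hnc => ?_⟩
  have hn0 : (0 : ℝ) < n := by exact_mod_cast hn
  have hM : (0 : ℝ) < (N : ℝ) ^ n := by positivity
  set E := {x : EuclideanSpace ℝ (Fin d) | ‖x‖ ≤ ρ ∧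
    n * c ≤ ‖lacunarySum N n (∑ l, k l * x l)‖} with hE
  -- New linear coordinates, with `k · x` in place of the coordinate `p`.
  let τ : EuclideanSpace ℝ (Fin d) → Fin d → ℝ := fun x l =>
    if l = p then ∑ l, k l * x l else x l
  have hτp : ∀ x, τ x p = ∑ l, k l * x l := fun x => if_pos rfl
  have hτl : ∀ x l, l ≠ p → τ x l = x l := fun x l h => if_neg h
  have hτ : ∀ x ∈ E, ∀ l, |τ x l| < L := by
    intro x hx l
    refine lt_of_le_of_lt ?_ hL
    have hx0 : ∀ l, |x l| ≤ |ρ| := fun l => by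
      have := PiLp.norm_apply_le x l
      rw [Real.norm_eq_abs] at this
      exact (this.trans hx.1).trans (le_abs_self ρ)
    by_cases hl : l = p
    · rw [hl, hτp]
      calc _ ≤ ∑ l, |(k l : ℝ)| * |ρ| := by
            refine (Finset.abs_sum_le_sum_abs _ _).trans (Finset.sum_le_sum fun l _ => ?_)
            rw [abs_mul]
            exact mul_le_mul_of_nonneg_left (hx0 l) (abs_nonneg _)
        _ = (∑ l, |(k l : ℝ)|) * |ρ| := by rw [Finset.sum_mul]
        _ ≤ B * |ρ| := by gcongr; linarith
    · rw [hτl x l hl]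
      exact (hx0 l).trans (le_mul_of_one_le_left (abs_nonneg _) hB1)
  have hτ0 : ∀ x ∈ E, ∀ l, 0 ≤ τ x l + L := fun x hx l => by
    have := (abs_lt.mp (hτ x hx l)).1; linarith
  -- The coordinate `r` is left free: a cell extends along the direction `v`. The integer shift `L`
  -- makes the floor arguments nonnegative without changing the lacunary sum.
  let φ : EuclideanSpace ℝ (Fin d) → Fin d → ℕ := fun x l =>
    if l = r then 0 else ⌊(N : ℝ) ^ n * (τ x l + L)⌋₊
  -- Halving the threshold absorbs the rounding error `2π`, because `4π ≤ n * c`.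
  set Good := (Finset.range (2 * L * N ^ n)).filter
      fun m : ℕ => n * (c / 2) ≤ ‖lacunarySum N n ((m : ℝ) / (N : ℝ) ^ n)‖ with hGood
  let Q : Fin d → Finset ℕ := fun l =>
    if l = r then {0} else if l = p then Good else Finset.range (2 * L * N ^ n)
  have hrange : ∀ x ∈ E, ∀ l, ⌊(N : ℝ) ^ n * (τ x l + L)⌋₊ < 2 * L * N ^ n := by
    intro x hx l
    rw [Nat.floor_lt (mul_nonneg hM.le (hτ0 x hx l))]
    have := (abs_lt.mp (hτ x hx l)).2
    push_cast
    nlinarith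
  have hφ : ∀ x ∈ E, φ x ∈ Fintype.piFinset Q := by
    intro x hx
    rw [Fintype.mem_piFinset]
    intro l
    by_cases hlr : l = r
    · simp [φ, Q, hlr]
    by_cases hlp : l = p
    · simp only [φ, Q, if_neg hlr, if_pos hlp, hGood, Finset.mem_filter, Finset.mem_range]
      refine ⟨hrange x hx l, ?_⟩
      subst hlp
      set t := τ x l + L with ht
      have h1 : lacunarySum N n t = lacunarySum N n (∑ l, k l * x l) := by
        rw [ht, lacunarySum_add_natCast, hτp]
      have h2 : |t - (⌊(N : ℝ) ^ n * t⌋₊ : ℝ) / (N : ℝ) ^ n| ≤ 1 / (N : ℝ) ^ n := by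
        have e : t - (⌊(N : ℝ) ^ n * t⌋₊ : ℝ) / (N : ℝ) ^ n =
          ((N : ℝ) ^ n * t - ⌊(N : ℝ) ^ n * t⌋₊) / (N : ℝ) ^ n := by field_simp
        rw [e, abs_div, abs_of_pos hM]
        gcongr
        have h3 := Nat.floor_le (mul_nonneg hM.le (hτ0 x hx l))
        have h4 := Nat.lt_floor_add_one ((N : ℝ) ^ n * t)
        rw [abs_le]; constructor <;> linarith
      have h5 := norm_lacunarySum_sub_le hN n h2
      have h6 := norm_sub_norm_le (lacunarySum N n t)
        (lacunarySum N n ((⌊(N : ℝ) ^ n * t⌋₊ : ℝ) / (N : ℝ) ^ n))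
      have h7 := hx.2
      rw [← h1] at h7
      linarith
    · simp only [φ, Q, if_neg hlr, if_neg hlp, Finset.mem_range]
      exact hrange x hx l
  have hcell := HasTubeCover.of_cells (E := E) (Fintype.piFinset Q) φ hφ hv
    (η := A * (1 / (N : ℝ) ^ n)) (by positivity) ?_
  · refine hcell.mono le_rfl ?_
    have hcard : (Fintype.piFinset Q).card = Good.card * (2 * L * N ^ n) ^ (d - 2) := by
      rw [Fintype.card_piFinset, ← Finset.mul_prod_erase _ _ (Finset.mem_univ p),
        ← Finset.mul_prod_erase _ _ (Finset.mem_erase.mpr ⟨hr, Finset.mem_univ r⟩)]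
      have hc2 : ((Finset.univ.erase p).erase r).card = d - 2 := by
        rw [Finset.card_erase_of_mem (Finset.mem_erase.mpr ⟨hr, Finset.mem_univ r⟩),
          Finset.card_erase_of_mem (Finset.mem_univ p), Finset.card_univ, Fintype.card_fin]
        omega
      rw [Finset.prod_congr rfl (g := fun _ => 2 * L * N ^ n), Finset.prod_const, hc2]
      · simp [Q, hr.symm]
      · intro l hl
        simp only [Finset.mem_erase] at hl
        simp [Q, hl.1, hl.2.1]
    have hG := card_filter_lacunarySum_le hN hn (2 * L) (half_pos hc)
    rw [← hGood] at hG
    rw [hcard]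
    have hsplit : ((N : ℝ) ^ n) ^ (d - 1) = (N : ℝ) ^ n * ((N : ℝ) ^ n) ^ (d - 2) := by
      rw [← pow_succ']; congr 1; omega
    calc ((Good.card * (2 * L * N ^ n) ^ (d - 2) : ℕ) : ℝ) *
          (2 * (A * (1 / (N : ℝ) ^ n))) ^ (d - 1)
        = Good.card * ((2 * L) ^ (d - 2) * (2 * A) ^ (d - 1) / (N : ℝ) ^ n) := by
          push_cast
          rw [mul_pow (2 * (L : ℝ)), show 2 * (A * (1 / (N : ℝ) ^ n)) = 2 * A / (N : ℝ) ^ n by ring,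
            div_pow, hsplit]
          field_simp
      _ ≤ ((2 * L : ℕ) : ℝ) * (N : ℝ) ^ n / (n * (c / 2) ^ 2) *
          ((2 * L) ^ (d - 2) * (2 * A) ^ (d - 1) / (N : ℝ) ^ n) := by gcongr
      _ = _ := by
          push_cast
          field_simp
          ring
  · intro x hx y hy hxy
    apply hvA
    · intro l hlp hlr
      have := congrFun hxy l
      simp only [φ, if_neg hlr] at this
      have h := abs_sub_le_of_natFloor_mul_eq hM (hτ0 x hx l) (hτ0 y hy l) this
      rw [hτl x l hlp, hτl y l hlp] at h
      simpa using h
    · have := congrFun hxy p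
      simp only [φ, if_neg hr.symm] at this
      have h := abs_sub_le_of_natFloor_mul_eq hM (hτ0 x hx p) (hτ0 y hy p) this
      rw [hτp, hτp] at h
      simp only [PiLp.sub_apply, mul_sub, Finset.sum_sub_distrib]
      simpa using h

/-! ### Trigonometric polynomials and orbits on the torus -/

open MeasureTheory

theorem integral_mFourier {d : ℕ} (k : Fin d → ℤ) (hk : k ≠ 0) :
    ∫ x, UnitAddTorus.mFourier k x
      ∂(Measure.pi fun _ : Fin d => (AddCircle.haarAddCircle : Measure UnitAddCircle)) = 0 := by
  obtain ⟨i, hi⟩ := Function.ne_iff.mp hk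
  have h := integral_fintype_prod_eq_prod (𝕜 := ℂ)
    (μ := fun _ : Fin d => (AddCircle.haarAddCircle : Measure UnitAddCircle))
    (fun (l : Fin d) (x : UnitAddCircle) => (fourier (k l) x : ℂ))
  refine h.trans (Finset.prod_eq_zero (Finset.mem_univ i) ?_)
  have h2 := congrFun (fourierCoeff_fourier (T := 1) (k i)) 0
  rw [Pi.single_eq_of_ne (Ne.symm hi : (0 : ℤ) ≠ k i), fourierCoeff] at h2
  simpa using h2

/-- A proper closed subset of the torus is detected by a trigonometric polynomial. -/
theorem exists_trigPoly_of_isClosed {d : ℕ} {K : Set (UnitAddTorus (Fin d))} (hK : IsClosed K)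
    (hne : K ≠ Set.univ) :
    ∃ (F : Finset (Fin d → ℤ)) (a : (Fin d → ℤ) → ℂ) (b : ℂ) (η : ℝ), 0 < η ∧ (0 ∉ F) ∧
      2 * η ≤ ‖b‖ ∧ ∀ x ∈ K, ‖b + ∑ k ∈ F, a k * UnitAddTorus.mFourier k x‖ ≤ η := by
  classical
  obtain ⟨x₀, hx₀⟩ := (Set.ne_univ_iff_exists_notMem K).mp hne
  obtain ⟨φ, hφK, hφ1, hφ01⟩ := exists_continuous_zero_one_of_isClosed hK
    (isClosed_singleton (x := x₀)) (Set.disjoint_singleton_right.mpr hx₀)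
  set μ := Measure.pi fun _ : Fin d => (AddCircle.haarAddCircle : Measure UnitAddCircle) with hμ
  have hint : ∀ g : C(UnitAddTorus (Fin d), ℂ), Integrable g μ := fun g =>
    g.continuous.integrable_of_hasCompactSupport (HasCompactSupport.of_compactSpace _)
  have hint' : Integrable φ μ :=
    φ.continuous.integrable_of_hasCompactSupport (HasCompactSupport.of_compactSpace _)
  set m := ∫ x, φ x ∂μ with hm
  have hm0 : 0 < m := by
    refine Continuous.integral_pos_of_hasCompactSupport_nonneg_nonzero φ.continuous
      (HasCompactSupport.of_compactSpace _) (fun x => (hφ01 x).1) (x := x₀) ?_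
    rw [hφ1 rfl]; simp
  let ψ : C(UnitAddTorus (Fin d), ℂ) := ⟨fun x => (φ x : ℂ), by fun_prop⟩
  have hψ : ψ ∈ (Submodule.span ℂ
      (Set.range (UnitAddTorus.mFourier (d := Fin d)))).topologicalClosure := by
    rw [UnitAddTorus.span_mFourier_closure_eq_top]; trivial
  -- With accuracy `m / 4`, the constant term of `P`, being its mean, has norm at least `3 * m / 4`,
  -- while `P` is at most `m / 4` where the bump function vanishes.
  obtain ⟨P, hP, hdist⟩ := Metric.mem_closure_iff.mp hψ (m / 4) (by positivity)
  obtain ⟨a, ha⟩ := (Finsupp.mem_span_range_iff_exists_finsupp).mp hP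
  have hPx : ∀ x, P x = a 0 + ∑ k ∈ a.support.erase 0, a k * UnitAddTorus.mFourier k x := by
    intro x
    have h1 : P x = ∑ k ∈ insert 0 a.support, a k * UnitAddTorus.mFourier k x := by
      rw [← ha, Finsupp.sum_of_support_subset a (Finset.subset_insert 0 a.support) _ (by simp)]
      simp [ContinuousMap.sum_apply]
    rw [h1, ← Finset.add_sum_erase _ _ (Finset.mem_insert_self 0 a.support),
      UnitAddTorus.mFourier_zero]
    simp
  have hPint : ∫ x, P x ∂μ = a 0 := by
    simp_rw [hPx]
    rw [integral_add (integrable_const _) (integrable_finsetSum _ fun k _ =>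
      (hint _).const_mul _), integral_finsetSum _ fun k _ => (hint _).const_mul _,
      Finset.sum_eq_zero]
    · simp
    · intro k hk
      rw [integral_const_mul, integral_mFourier k (Finset.ne_of_mem_erase hk), mul_zero]
  have hsup : ∀ x, ‖ψ x - P x‖ ≤ m / 4 := fun x => by
    rw [dist_eq_norm] at hdist
    exact ((ψ - P).norm_coe_le_norm x).trans hdist.le
  refine ⟨a.support.erase 0, a, a 0, m / 4, by positivity, Finset.notMem_erase _ _, ?_, ?_⟩
  · have h1 : ∫ x, (ψ x - P x) ∂μ = (m : ℂ) - a 0 := by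
      rw [integral_sub (hint _) (hint _), hPint]
      congr 1
      exact integral_ofReal
    have h2 : ‖(m : ℂ) - a 0‖ ≤ m / 4 := by
      rw [← h1]
      simpa using norm_integral_le_of_norm_le_const (μ := μ) (Filter.Eventually.of_forall hsup)
    have h3 := norm_sub_norm_le (m : ℂ) (a 0)
    rw [Complex.norm_real, Real.norm_of_nonneg hm0.le] at h3
    linarith
  · intro x hx
    rw [← hPx]
    have h0 : ψ x = 0 := by
      change ((φ x : ℝ) : ℂ) = 0
      rw [hφK hx]; simp
    simpa [h0] using hsup x

/-- The projection of Euclidean space onto the torus. -/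
def toTorus {d : ℕ} (x : EuclideanSpace ℝ (Fin d)) : UnitAddTorus (Fin d) :=
  fun l => (x l : UnitAddCircle)

theorem continuous_toTorus {d : ℕ} : Continuous (toTorus (d := d)) :=
  continuous_pi fun l => (AddCircle.continuous_mk' 1).comp (by fun_prop)

theorem mFourier_toTorus_smul {d : ℕ} (k : Fin d → ℤ) (x : EuclideanSpace ℝ (Fin d)) (s : ℝ) :
    UnitAddTorus.mFourier k (toTorus (s • x)) =
      Complex.exp (2 * Real.pi * Complex.I * (s * (∑ l, k l * x l : ℝ))) := by
  change ∏ l, fourier (k l) ((s • x) l : UnitAddCircle) = _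
  simp_rw [fourier_coe_apply]
  rw [← Complex.exp_sum]
  congr 1
  push_cast
  rw [Finset.mul_sum, Finset.mul_sum]
  refine Finset.sum_congr rfl fun l _ => ?_
  simp
  ring

/-- If the orbit of `x` under multiplication by `N` avoids an open set modulo `ℤ ^ d`, then one of
finitely many lacunary sums at `x` is large. -/
theorem exists_lacunarySum_ge {d N : ℕ} {K : Set (UnitAddTorus (Fin d))} (hK : IsClosed K)
    (hne : K ≠ Set.univ) :
    ∃ (F : Finset (Fin d → ℤ)) (c : ℝ), 0 < c ∧ 0 ∉ F ∧
      ∀ x : EuclideanSpace ℝ (Fin d), (∀ j : ℕ, toTorus ((N : ℝ) ^ j • x) ∈ K) →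
        ∀ n : ℕ, 0 < n → ∃ k ∈ F, n * c ≤ ‖lacunarySum N n (∑ l, k l * x l)‖ := by
  obtain ⟨F, a, b, η, hη, h0, hb, hF⟩ := exists_trigPoly_of_isClosed hK hne
  -- The extra `1` gives strictness: if all lacunary sums were below `n * (η / A)`, then `n * ‖b‖ ≤
  -- 2 * n * η - n * (η / A)`, against `2 * η ≤ ‖b‖`.
  set A := 1 + ∑ k ∈ F, ‖a k‖ with hA
  have hA0 : 0 < A := by
    have : 0 ≤ ∑ k ∈ F, ‖a k‖ := Finset.sum_nonneg fun _ _ => norm_nonneg _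
    linarith
  refine ⟨F, η / A, by positivity, h0, fun x hx n hn => ?_⟩
  by_contra! hcon
  have hn0 : (0 : ℝ) < n := by exact_mod_cast hn
  have h1 : ∑ j ∈ Finset.range n,
      (b + ∑ k ∈ F, a k * UnitAddTorus.mFourier k (toTorus ((N : ℝ) ^ j • x))) =
      n * b + ∑ k ∈ F, a k * lacunarySum N n (∑ l, k l * x l) := by
    rw [Finset.sum_add_distrib, Finset.sum_const, Finset.card_range, nsmul_eq_mul,
      Finset.sum_comm]
    congr 1
    refine Finset.sum_congr rfl fun k _ => ?_
    rw [lacunarySum, Finset.mul_sum]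
    refine Finset.sum_congr rfl fun j _ => ?_
    rw [mFourier_toTorus_smul]
    push_cast
    rfl
  have h2 : ‖(n : ℂ) * b + ∑ k ∈ F, a k * lacunarySum N n (∑ l, k l * x l)‖ ≤ n * η := by
    rw [← h1]
    refine (norm_sum_le _ _).trans ((Finset.sum_le_sum fun j _ => hF _ (hx j)).trans ?_)
    simp
  have h3 : ‖∑ k ∈ F, a k * lacunarySum N n (∑ l, k l * x l)‖ ≤ (A - 1) * (n * (η / A)) := by
    refine (norm_sum_le _ _).trans ?_
    rw [hA, add_sub_cancel_left, Finset.sum_mul]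
    refine Finset.sum_le_sum fun k hk => ?_
    rw [norm_mul]
    gcongr
    exact (hcon k hk).le
  have h4 : ‖(n : ℂ) * b‖ ≤ n * η + (A - 1) * (n * (η / A)) := by
    have := norm_sub_le ((n : ℂ) * b + ∑ k ∈ F, a k * lacunarySum N n (∑ l, k l * x l))
      (∑ k ∈ F, a k * lacunarySum N n (∑ l, k l * x l))
    rw [add_sub_cancel_right] at this
    linarith
  rw [norm_mul, Complex.norm_natCast] at h4
  have h5 : (A - 1) * (n * (η / A)) = n * η - n * (η / A) := by field_simp
  have h6 : 0 < n * (η / A) := by positivity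
  nlinarith

/-! ### Tube-null bounded sets have measure zero -/

/-- The part of the tube in the ball is covered by `O(1/w)` balls of radius `2 * w` centred on its
axis, each of volume `O(w ^ d)`. -/
theorem volume_tube_inter_closedBall_le {d : ℕ} (hd : 1 ≤ d) {ρ : ℝ} (hρ : 0 ≤ ρ) :
    ∃ C : ℝ, ∀ (w : ℝ) (T : Set (EuclideanSpace ℝ (Fin d))), w ≤ 1 → IsTube w T →
      volume (T ∩ Metric.closedBall 0 ρ) ≤ ENNReal.ofReal (C * w ^ (d - 1)) := by
  refine ⟨(4 * ρ + 7) * 2 ^ d * (volume (Metric.ball (0 : EuclideanSpace ℝ (Fin d)) 1)).toReal,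
    fun w T hw1 hT => ?_⟩
  obtain ⟨hw, p, u, hu, rfl⟩ := hT
  set v := ‖u‖⁻¹ • u with hv
  have hu0 : 0 < ‖u‖ := norm_pos_iff.mpr hu
  have hv1 : ‖v‖ = 1 := by rw [hv, norm_smul, norm_inv, norm_norm, inv_mul_cancel₀ hu0.ne']
  set Z := Metric.cthickening (w / 2) (Set.range fun t : ℝ => p + t • u) ∩ Metric.closedBall 0 ρ
    with hZ
  have hnear : ∀ x ∈ Z, ∃ t : ℝ, dist x (p + t • v) < w := by
    intro x hx
    have h1 : x ∈ Metric.thickening w (Set.range fun t : ℝ => p + t • u) :=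
      Metric.cthickening_subset_thickening' hw (by linarith) _ hx.1
    obtain ⟨_, ⟨t, rfl⟩, ht⟩ := Metric.mem_thickening_iff.mp h1
    refine ⟨t * ‖u‖, ?_⟩
    rw [hv, smul_smul, mul_assoc, mul_inv_cancel₀ hu0.ne', mul_one]
    exact ht
  rcases Z.eq_empty_or_nonempty with h | ⟨x₀, hx₀⟩
  · rw [h]; simp
  obtain ⟨t₀, ht₀⟩ := hnear x₀ hx₀
  -- Two points of `Z` are at most `2 * ρ` apart, and passing to the axis costs less than `w ≤ 1` at
  -- each end.
  set R := 2 * ρ + 2 with hR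
  set n := ⌈R / w⌉₊ with hn
  have hcover : Z ⊆ ⋃ j ∈ Finset.Icc (-(n : ℤ)) n,
      Metric.closedBall (p + (t₀ + j * w) • v) (2 * w) := by
    intro x hx
    obtain ⟨t, ht⟩ := hnear x hx
    have habs : |t - t₀| ≤ R := by
      have h1 : dist (p + t • v) (p + t₀ • v) = |t - t₀| := by
        rw [dist_add_left, dist_eq_norm, ← sub_smul, norm_smul, hv1, mul_one, Real.norm_eq_abs]
      rw [← h1]
      have h2 := dist_triangle4 (p + t • v) x x₀ (p + t₀ • v)
      rw [dist_comm _ x] at h2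
      have h3 := dist_triangle_right x x₀ 0
      have h4 := Metric.mem_closedBall.mp hx.2
      have h5 := Metric.mem_closedBall.mp hx₀.2
      linarith
    set j := ⌊(t - t₀) / w⌋ with hj
    have hj1 : (j : ℝ) ≤ (t - t₀) / w := Int.floor_le _
    have hj2 : (t - t₀) / w < j + 1 := Int.lt_floor_add_one _
    have hq : |(t - t₀) / w| ≤ n := by
      rw [abs_div, abs_of_pos hw]
      exact (div_le_div_of_nonneg_right habs hw.le).trans (Nat.le_ceil _)
    rw [abs_le] at hq
    refine Set.mem_iUnion₂.mpr ⟨j, ?_, ?_⟩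
    · rw [Finset.mem_Icc]
      constructor
      · rw [hj, Int.le_floor]; push_cast; exact hq.1
      · have : (j : ℝ) ≤ n := hj1.trans hq.2
        exact_mod_cast this
    · rw [Metric.mem_closedBall]
      have h6 : dist (p + t • v) (p + (t₀ + j * w) • v) ≤ w := by
        rw [dist_add_left, dist_eq_norm, ← sub_smul, norm_smul, hv1, mul_one, Real.norm_eq_abs]
        rw [le_div_iff₀ hw] at hj1
        rw [div_lt_iff₀ hw] at hj2
        rw [abs_le]; constructor <;> linarith
      have := dist_triangle x (p + t • v) (p + (t₀ + j * w) • v)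
      linarith
  set β := volume (Metric.ball (0 : EuclideanSpace ℝ (Fin d)) 1) with hβ
  have hβt : β ≠ ⊤ := measure_ball_lt_top.ne
  calc volume Z ≤ ∑ j ∈ Finset.Icc (-(n : ℤ)) n,
        volume (Metric.closedBall (p + (t₀ + j * w) • v) (2 * w)) :=
        (measure_mono hcover).trans (measure_biUnion_finset_le _ _)
    _ = ((2 * n + 1 : ℕ) : ENNReal) * (ENNReal.ofReal ((2 * w) ^ d) * β) := by
        have hc : (Finset.Icc (-(n : ℤ)) n).card = 2 * n + 1 := by
          rw [Int.card_Icc]; omega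
        rw [Finset.sum_congr rfl fun j _ => Measure.addHaar_closedBall volume _
          (by positivity : 0 ≤ 2 * w), Finset.sum_const, hc, finrank_euclideanSpace_fin,
          nsmul_eq_mul]
    _ = ENNReal.ofReal (((2 * n + 1 : ℕ) : ℝ) * ((2 * w) ^ d * β.toReal)) := by
        rw [ENNReal.ofReal_mul (by positivity), ENNReal.ofReal_mul (by positivity),
          ENNReal.ofReal_toReal hβt, ENNReal.ofReal_natCast]
    _ ≤ _ := by
        apply ENNReal.ofReal_le_ofReal
        have h1 : ((2 * n + 1 : ℕ) : ℝ) * w ≤ 4 * ρ + 7 := by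
          have h2 : (n : ℝ) ≤ R / w + 1 := (Nat.ceil_lt_add_one (by positivity)).le
          have h3 : R / w * w = R := div_mul_cancel₀ _ hw.ne'
          push_cast
          nlinarith
        have h4 : w ^ d = w * w ^ (d - 1) := by rw [← pow_succ']; congr 1; omega
        calc _ = (((2 * n + 1 : ℕ) : ℝ) * w) * (2 ^ d * β.toReal * w ^ (d - 1)) := by
              rw [mul_pow, h4]; ring
          _ ≤ (4 * ρ + 7) * (2 ^ d * β.toReal * w ^ (d - 1)) := by gcongr
          _ = _ := by ring

/-- Bounded tube-null sets are Lebesgue null. -/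
theorem TubeNull.volume_eq_zero {d : ℕ} (hd : 2 ≤ d) {K : Set (EuclideanSpace ℝ (Fin d))}
    (hK : TubeNull K) (hb : Bornology.IsBounded K) : volume K = 0 := by
  obtain ⟨ρ, hρ⟩ := hb.subset_closedBall (0 : EuclideanSpace ℝ (Fin d))
  obtain ⟨C, hC⟩ := volume_tube_inter_closedBall_le (d := d) (by omega) (abs_nonneg ρ)
  have hle : ∀ ε : ℝ, 0 < ε → ε ≤ 1 → volume K ≤ ENNReal.ofReal (|C| * ε) := by
    intro ε hε hε1
    obtain ⟨T, w, hT, hcov, hsum, hlt⟩ := hK ε hε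
    have hpos : ∀ n, 0 ≤ w n ^ (d - 1) := fun n => pow_nonneg (hT n).1.le _
    have hw1 : ∀ n, w n ≤ 1 := by
      intro n
      by_contra! h
      have h1 := one_le_pow₀ (n := d - 1) h.le
      have h2 := hsum.le_tsum n fun m _ => hpos m
      linarith
    calc volume K ≤ volume (⋃ n, T n ∩ Metric.closedBall 0 |ρ|) := by
          apply measure_mono
          intro x hx
          obtain ⟨n, hn⟩ := Set.mem_iUnion.mp (hcov hx)
          exact Set.mem_iUnion.mpr
            ⟨n, hn, Metric.closedBall_subset_closedBall (le_abs_self ρ) (hρ hx)⟩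
      _ ≤ ∑' n, volume (T n ∩ Metric.closedBall 0 |ρ|) := measure_iUnion_le _
      _ ≤ ∑' n, ENNReal.ofReal (|C| * w n ^ (d - 1)) := by
          refine ENNReal.tsum_le_tsum fun n => (hC _ _ (hw1 n) (hT n)).trans ?_
          apply ENNReal.ofReal_le_ofReal
          exact mul_le_mul_of_nonneg_right (le_abs_self C) (hpos n)
      _ = ENNReal.ofReal (∑' n, |C| * w n ^ (d - 1)) :=
          (ENNReal.ofReal_tsum_of_nonneg (fun n => mul_nonneg (abs_nonneg _) (hpos n))
            (hsum.mul_left _)).symm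
      _ ≤ _ := by
          apply ENNReal.ofReal_le_ofReal
          rw [tsum_mul_left]
          gcongr
  have hlim : Filter.Tendsto (fun ε : ℝ => ENNReal.ofReal (|C| * ε)) (nhdsWithin 0 (Set.Ioi 0))
      (nhds 0) := by
    have : Continuous fun ε : ℝ => ENNReal.ofReal (|C| * ε) :=
      ENNReal.continuous_ofReal.comp (by fun_prop)
    simpa using (this.tendsto 0).mono_left nhdsWithin_le_nhds
  refine le_antisymm (ge_of_tendsto hlim ?_) zero_le
  filter_upwards [Ioc_mem_nhdsGT (zero_lt_one (α := ℝ))] with ε hε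
  exact hle ε hε.1 hε.2

/-! ### Grid maps and integer isometries -/

/-- Sets whose image under a grid map is Lebesgue null are Lebesgue null. -/
theorem IsGridMap.volume_eq_zero {d N : ℕ} (hN : N ≠ 0)
    {g : EuclideanSpace ℝ (Fin d) → EuclideanSpace ℝ (Fin d)} (hg : IsGridMap N g)
    {A : Set (EuclideanSpace ℝ (Fin d))} (hA : volume (g '' A) = 0) : volume A = 0 := by
  obtain ⟨R, i, -, hR⟩ := hg
  have hN' : (N : ℝ) ≠ 0 := by exact_mod_cast hN
  set b : EuclideanSpace ℝ (Fin d) := WithLp.toLp 2 fun k => ((i k : ℕ) : ℝ) with hb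
  set S := R.symm.toRealAffineIsometryEquiv with hS
  have hinv : ∀ x, S ((N : ℝ) • g x - b) = x := by
    intro x
    have h1 : (N : ℝ) • g x - b = R x := by
      ext k
      simp only [PiLp.sub_apply, PiLp.smul_apply, smul_eq_mul, hR, hb]
      field_simp
      ring
    rw [h1, hS, IsometryEquiv.coeFn_toRealAffineIsometryEquiv, R.symm_apply_apply]
  have hdiff : Differentiable ℝ fun y => S ((N : ℝ) • y - b) := by
    have : Differentiable ℝ S :=
      (S.toAffineIsometry.toContinuousAffineMap.contDiff (n := 1)).differentiable one_ne_zero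
    exact this.comp (by fun_prop)
  have h2 : A = (fun y => S ((N : ℝ) • y - b)) '' (g '' A) := by
    rw [Set.image_image]; simp [hinv]
  rw [h2]
  exact addHaar_image_eq_zero_of_differentiableOn_of_addHaar_eq_zero volume
    hdiff.differentiableOn hA

/-- The points of `ℝ ^ d` with integer coordinates. -/
def integerPoints (d : ℕ) : AddSubgroup (EuclideanSpace ℝ (Fin d)) where
  carrier := {x | ∀ l, ∃ z : ℤ, x l = z}
  zero_mem' := fun l => ⟨0, by simp⟩
  add_mem' := by
    intro x y hx hy l
    obtain ⟨a, ha⟩ := hx l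
    obtain ⟨b, hb⟩ := hy l
    exact ⟨a + b, by simp [ha, hb]⟩
  neg_mem' := by
    intro x hx l
    obtain ⟨a, ha⟩ := hx l
    exact ⟨-a, by simp [ha]⟩

/-- The linear isometries of `ℝ ^ d` that preserve `ℤ ^ d`. -/
def integerIsometries (d : ℕ) :
    Set (EuclideanSpace ℝ (Fin d) ≃ₗᵢ[ℝ] EuclideanSpace ℝ (Fin d)) :=
  {A | ∀ z ∈ integerPoints d, A z ∈ integerPoints d}

theorem single_one_mem_integerPoints {d : ℕ} (l : Fin d) :
    EuclideanSpace.single l (1 : ℝ) ∈ integerPoints d := by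
  intro m
  by_cases h : m = l
  · exact ⟨1, by simp [h]⟩
  · exact ⟨0, by simp [h]⟩

theorem sum_smul_single {d : ℕ} (x : EuclideanSpace ℝ (Fin d)) :
    ∑ l, x l • EuclideanSpace.single l (1 : ℝ) = x := by
  ext m; simp [Finset.sum_apply, Pi.single_apply]

theorem mem_integerIsometries_of_single {d : ℕ}
    {A : EuclideanSpace ℝ (Fin d) ≃ₗᵢ[ℝ] EuclideanSpace ℝ (Fin d)}
    (h : ∀ l, A (EuclideanSpace.single l 1) ∈ integerPoints d) : A ∈ integerIsometries d := by
  intro x hx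
  rw [← sum_smul_single x, map_sum]
  refine sum_mem fun l _ => ?_
  obtain ⟨z, hz⟩ := hx l
  rw [hz, map_smul, Int.cast_smul_eq_zsmul]
  exact zsmul_mem (h l) z

/-- The matrix entries are integers of absolute value at most `1`. Finiteness is what keeps the
union of images of the `K j` compact. -/
theorem finite_integerIsometries (d : ℕ) : (integerIsometries d).Finite := by
  have hfin : (Set.pi Set.univ fun _ : Fin d =>
      Set.pi Set.univ fun _ : Fin d => Set.Icc (-1 : ℤ) 1).Finite :=
    Set.Finite.pi fun _ => Set.Finite.pi fun _ => Set.finite_Icc _ _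
  refine Set.Finite.of_injOn
    (f := fun A k l => ⌊A (EuclideanSpace.single k 1) l⌋) ?_ ?_ hfin
  · intro A _ k _ l _
    have h1 : |A (EuclideanSpace.single k 1) l| ≤ 1 := by
      have := PiLp.norm_apply_le (A (EuclideanSpace.single k 1)) l
      rwa [A.norm_map, PiLp.norm_single, norm_one, Real.norm_eq_abs] at this
    rw [abs_le] at h1
    constructor
    · exact Int.le_floor.mpr (by push_cast; exact h1.1)
    · exact Int.cast_le.mp (((Int.floor_le _).trans h1.2).trans_eq Int.cast_one.symm)
  · intro A hA B hB hAB
    have h1 : ∀ k, A (EuclideanSpace.single k 1) = B (EuclideanSpace.single k 1) := by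
      intro k
      ext l
      obtain ⟨a, ha⟩ := hA _ (single_one_mem_integerPoints k) l
      obtain ⟨b, hb⟩ := hB _ (single_one_mem_integerPoints k) l
      have := congrFun (congrFun hAB k) l
      simp only [ha, hb, Int.floor_intCast] at this
      rw [ha, hb, this]
    ext1 x
    rw [← sum_smul_single x]
    simp only [map_sum, map_smul, h1]

/-- Opposite vertices realise the diameter of the cube, and so do their images. Two points of the
cube at that distance must differ by exactly `1` in every coordinate, so both are vertices. -/
theorem isometry_unitCube_vertex {d : ℕ}
    {R : EuclideanSpace ℝ (Fin d) ≃ᵢ EuclideanSpace ℝ (Fin d)} (hR : R '' unitCube d = unitCube d)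
    {v : EuclideanSpace ℝ (Fin d)} (hv : ∀ l, v l = 0 ∨ v l = 1) (l : Fin d) :
    R v l = 0 ∨ R v l = 1 := by
  set v' : EuclideanSpace ℝ (Fin d) := WithLp.toLp 2 fun l => 1 - v l with hv'
  have hvc : v ∈ unitCube d := fun l => by rcases hv l with h | h <;> simp [h]
  have hvc' : v' ∈ unitCube d := fun l => by rcases hv l with h | h <;> simp [hv', h]
  have hx : R v ∈ unitCube d := hR ▸ Set.mem_image_of_mem R hvc
  have hy : R v' ∈ unitCube d := hR ▸ Set.mem_image_of_mem R hvc'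
  have hle : ∀ m ∈ Finset.univ, (R v m - R v' m) ^ 2 ≤ 1 := by
    intro m _
    obtain ⟨h1, h2⟩ := hx m
    obtain ⟨h3, h4⟩ := hy m
    nlinarith
  have hd2 : ∑ m, (R v m - R v' m) ^ 2 = ∑ _m : Fin d, (1 : ℝ) := by
    have h1 := R.dist_eq v v'
    rw [EuclideanSpace.dist_eq, EuclideanSpace.dist_eq, Real.sqrt_inj
      (Finset.sum_nonneg fun _ _ => sq_nonneg _) (Finset.sum_nonneg fun _ _ => sq_nonneg _)] at h1
    simp only [Real.dist_eq, sq_abs] at h1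
    rw [h1]
    refine Finset.sum_congr rfl fun m _ => ?_
    rcases hv m with h | h <;> simp [hv', h]
  have h5 := (Finset.sum_eq_sum_iff_of_le hle).mp hd2 l (Finset.mem_univ l)
  obtain ⟨h1, h2⟩ := hx l
  obtain ⟨h3, h4⟩ := hy l
  rcases sq_eq_one_iff.mp h5 with h | h
  · right; linarith
  · left; linarith

/-- A grid map is, up to scaling, an integer isometry modulo `ℤ ^ d`. -/
theorem IsGridMap.exists_integerIsometry {d N : ℕ} (hN : N ≠ 0)
    {g : EuclideanSpace ℝ (Fin d) → EuclideanSpace ℝ (Fin d)} (hg : IsGridMap N g) :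
    ∃ A ∈ integerIsometries d, ∃ b ∈ integerPoints d, ∀ x, (N : ℝ) • g x = A x + b := by
  obtain ⟨R, i, hR, hg⟩ := hg
  have hN' : (N : ℝ) ≠ 0 := by exact_mod_cast hN
  set S := R.toRealAffineIsometryEquiv with hS
  have hSR : ∀ x, S x = R x := fun x => by rw [hS, IsometryEquiv.coeFn_toRealAffineIsometryEquiv]
  have hA : ∀ x, S.linearIsometryEquiv x = R x - R 0 := by
    intro x
    have := S.map_vsub x 0
    simpa [hSR] using this
  have h01 : ∀ v : EuclideanSpace ℝ (Fin d), (∀ l, v l = 0 ∨ v l = 1) →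
      R v ∈ integerPoints d := by
    intro v hv l
    rcases isometry_unitCube_vertex hR hv l with h | h
    · exact ⟨0, by simp [h]⟩
    · exact ⟨1, by simp [h]⟩
  have hR0 : R 0 ∈ integerPoints d := h01 0 fun l => Or.inl (by simp)
  set b : EuclideanSpace ℝ (Fin d) := WithLp.toLp 2 fun k => ((i k : ℕ) : ℝ) with hb
  refine ⟨S.linearIsometryEquiv, mem_integerIsometries_of_single fun l => ?_, R 0 + b,
    add_mem hR0 fun l => ⟨(i l : ℕ), by simp [hb]⟩, fun x => ?_⟩
  · rw [hA]
    refine sub_mem (h01 _ fun m => ?_) hR0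
    by_cases h : m = l
    · right; simp [h]
    · left; simp [h]
  · rw [hA]
    ext k
    simp only [PiLp.add_apply, PiLp.sub_apply, PiLp.smul_apply, smul_eq_mul, hg, hb]
    field_simp
    ring

theorem toTorus_eq_toTorus_iff {d : ℕ} {x y : EuclideanSpace ℝ (Fin d)} :
    toTorus x = toTorus y ↔ x - y ∈ integerPoints d := by
  rw [funext_iff]
  refine forall_congr' fun l => ?_
  change ((x l : ℝ) : UnitAddCircle) = ((y l : ℝ) : UnitAddCircle) ↔ _
  rw [← sub_eq_zero, ← AddCircle.coe_sub, AddCircle.coe_eq_zero_iff]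
  simp [eq_comm]

theorem countable_integerPoints (d : ℕ) :
    (integerPoints d : Set (EuclideanSpace ℝ (Fin d))).Countable := by
  refine (Set.countable_range fun z : Fin d → ℤ =>
    (WithLp.toLp 2 fun l => (z l : ℝ) : EuclideanSpace ℝ (Fin d))).mono ?_
  intro x hx
  choose z hz using hx
  exact ⟨z, by ext l; simp [hz]⟩

/-! ### Graph directed sets -/

section GraphDirected

variable {d N : ℕ} {V : Type*} [Quiver V]
  {f : ∀ {i j : V}, (i ⟶ j) → EuclideanSpace ℝ (Fin d) → EuclideanSpace ℝ (Fin d)}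
  {K : V → Set (EuclideanSpace ℝ (Fin d))}

theorem IsGraphDirected.image_subset (hK : IsGraphDirected f K) {i j : V} (e : i ⟶ j) :
    f e '' K j ⊆ K i := by
  rw [hK.eq_iUnion i]
  exact Set.subset_iUnion₂_of_subset j e le_rfl

theorem IsGraphDirected.exists_pow_smul_eq (hK : IsGraphDirected f K) (hN : N ≠ 0)
    (hf : ∀ {i j : V} (e : i ⟶ j), IsGridMap N (f e)) {i : V} {x : EuclideanSpace ℝ (Fin d)}
    (hx : x ∈ K i) (n : ℕ) :
    ∃ A ∈ integerIsometries d, ∃ j, ∃ y ∈ K j, ∃ b ∈ integerPoints d,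
      (N : ℝ) ^ n • x = A y + b := by
  induction n with
  | zero =>
    exact ⟨LinearIsometryEquiv.refl ℝ _, fun z hz => hz, i, x, hx, 0, zero_mem _, by simp⟩
  | succ n ih =>
    obtain ⟨A, hA, j, y, hy, b, hb, h⟩ := ih
    rw [hK.eq_iUnion j] at hy
    obtain ⟨m, e, y', hy', rfl⟩ := Set.mem_iUnion₂.mp hy
    obtain ⟨A', hA', b', hb', h'⟩ := (hf e).exists_integerIsometry hN
    refine ⟨A'.trans A, fun z hz => hA _ (hA' z hz), m, y', hy', A b' + (N : ℤ) • b,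
      add_mem (hA _ hb') (zsmul_mem hb _), ?_⟩
    rw [pow_succ', mul_smul, h, smul_add, ← map_smul, h', map_add, ← Int.cast_smul_eq_zsmul ℝ]
    simp [add_assoc]

theorem IsGraphDirected.volume_eq_zero_of_path (hK : IsGraphDirected f K) (hN : N ≠ 0)
    (hf : ∀ {i j : V} (e : i ⟶ j), IsGridMap N (f e)) {i j : V} (p : Quiver.Path i j)
    (hi : volume (K i) = 0) : volume (K j) = 0 := by
  induction p with
  | nil => exact hi
  | cons _ e ih => exact (hf e).volume_eq_zero hN (measure_mono_null (hK.image_subset e) ih)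

theorem IsGraphDirected.tubeNull [Finite V] (hK : IsGraphDirected f K) (hd : 2 ≤ d) (hN : 2 ≤ N)
    (hf : ∀ {i j : V} (e : i ⟶ j), IsGridMap N (f e)) (h0 : ∀ j, volume (K j) = 0) (i : V) :
    TubeNull (K i) := by
  have hN0 : N ≠ 0 := by omega
  set Q : Set (UnitAddTorus (Fin d)) := ⋃ A ∈ integerIsometries d, ⋃ j, toTorus '' (A '' K j)
    with hQ
  have hQc : IsClosed Q := by
    refine IsCompact.isClosed ((finite_integerIsometries d).isCompact_biUnion fun A _ =>
      isCompact_iUnion fun j => ?_)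
    exact ((hK.isCompact j).image A.continuous).image continuous_toTorus
  -- If `Q` were the whole torus, countably many null sets, the integer translates of the `A '' K
  -- j`, would cover `ℝ ^ d`.
  have hQne : Q ≠ Set.univ := by
    intro hQu
    have hnull : volume (⋃ A ∈ integerIsometries d, ⋃ j, ⋃ b ∈ integerPoints d,
        (fun x => b + x) '' (A '' K j)) = 0 := by
      rw [measure_biUnion_null_iff (finite_integerIsometries d).countable]
      intro A _
      rw [measure_iUnion_null_iff]
      intro j
      refine (measure_biUnion_null_iff (countable_integerPoints d)).mpr fun b _ => ?_
      rw [Set.image_add_left, measure_preimage_add]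
      exact addHaar_image_eq_zero_of_differentiableOn_of_addHaar_eq_zero volume
        A.differentiable.differentiableOn (h0 j)
    have huniv : (⋃ A ∈ integerIsometries d, ⋃ j, ⋃ b ∈ integerPoints d,
        (fun x => b + x) '' (A '' K j)) = Set.univ := by
      refine Set.eq_univ_of_forall fun x => ?_
      have hx : toTorus x ∈ Q := hQu ▸ Set.mem_univ _
      simp only [hQ, Set.mem_iUnion] at hx
      obtain ⟨A, hA, j, y, hy, hxy⟩ := hx
      simp only [Set.mem_iUnion]
      exact ⟨A, hA, j, x - y, toTorus_eq_toTorus_iff.mp hxy.symm, y, hy, by simp⟩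
    rw [huniv] at hnull
    exact (isOpen_univ.measure_pos volume Set.univ_nonempty).ne' hnull
  obtain ⟨F, c, hc, hF0, hF⟩ := exists_lacunarySum_ge (N := N) hQc hQne
  obtain ⟨ρ, hρ⟩ := (hK.isCompact i).isBounded.subset_closedBall
    (0 : EuclideanSpace ℝ (Fin d))
  have hC : ∀ k ∈ F, ∃ C : ℝ, ∀ n : ℕ, 0 < n → 4 * Real.pi ≤ n * c → HasTubeCover
      {x : EuclideanSpace ℝ (Fin d) | ‖x‖ ≤ ρ ∧ n * c ≤ ‖lacunarySum N n (∑ l, k l * x l)‖}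
      (C / n) := fun k hk =>
    hasTubeCover_lacunarySum hd hN k (fun h => hF0 (h ▸ hk)) hc ρ
  choose! C hC using hC
  set D := ∑ k ∈ F, |C k| with hD
  refine TubeNull.of_hasTubeCover hd fun ε hε => ?_
  -- The first bound makes the tube covers available; the second makes their total cost over all
  -- frequencies in `F` at most `ε`.
  obtain ⟨n, hn⟩ := exists_nat_gt (max (4 * Real.pi / c) (F.card * D / ε))
  have hn1 : 4 * Real.pi ≤ n * c := by
    rw [← div_le_iff₀ hc]; exact (le_max_left _ _).trans hn.le
  have hn0 : (0 : ℝ) < n := by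
    have : (0 : ℝ) < 4 * Real.pi / c := by positivity
    exact this.trans_le ((le_max_left _ _).trans hn.le)
  have hn2 : F.card * (D / n) ≤ ε := by
    have := (le_max_right _ _).trans hn.le
    rw [div_le_iff₀ hε] at this
    rw [← mul_div_assoc, div_le_iff₀ hn0]
    linarith
  have hn0' : 0 < n := by exact_mod_cast hn0
  refine (HasTubeCover.biUnion F _ fun k hk => ((hC k hk n hn0' hn1).mono le_rfl
    (ε' := D / n) ?_)).mono ?_ hn2
  · gcongr
    exact (le_abs_self _).trans
      (Finset.single_le_sum (f := fun k => |C k|) (fun k _ => abs_nonneg _) hk)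
  · intro x hx
    obtain ⟨k, hk, hkx⟩ := hF x (fun m => by
      obtain ⟨A, hA, j, y, hy, b, hb, h⟩ := hK.exists_pow_smul_eq hN0 hf hx m
      simp only [hQ, Set.mem_iUnion]
      exact ⟨A, hA, j, A y, ⟨y, hy, rfl⟩, toTorus_eq_toTorus_iff.mpr (by
        rw [h, sub_add_cancel_left]; exact neg_mem hb)⟩) n hn0'
    exact Set.mem_iUnion₂.mpr ⟨k, hk, by simpa using hρ hx, hkx⟩

end GraphDirected

theorem mainTheorem2 {d N : ℕ} (hd : 2 ≤ d) (hN : 2 ≤ N)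
    (F : Set (EuclideanSpace ℝ (Fin d) → EuclideanSpace ℝ (Fin d))) (hFfin : F.Finite)
    (hF : ∀ g ∈ F, IsGridMap N g)
    {V : Type*} [Finite V] [Quiver V]
    (hconn : Quiver.IsStronglyConnected V)
    (f : ∀ {i j : V}, (i ⟶ j) → EuclideanSpace ℝ (Fin d) → EuclideanSpace ℝ (Fin d))
    (hf : ∀ {i j : V} (e : i ⟶ j), f e ∈ F)
    (K : V → Set (EuclideanSpace ℝ (Fin d))) (hK : IsGraphDirected f K) :
    ∀ i, TubeNull (K i) ↔ ∀ j, MeasureTheory.volume (K j) = 0 := by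
  intro i
  have hgrid : ∀ {i j : V} (e : i ⟶ j), IsGridMap N (f e) := fun e => hF _ (hf e)
  refine ⟨fun h j => ?_, fun h => hK.tubeNull hd hN hgrid h i⟩
  obtain ⟨p⟩ := hconn i j
  exact hK.volume_eq_zero_of_path (by omega) hgrid p
    (h.volume_eq_zero hd (hK.isCompact i).isBounded)
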